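/- **Setting.** Let $Q$ be a quasiorder and $\mathcal N=\omega^\omega$ the Baire space. *Terms and trees.* Let $\mathbb T_\sigma$ be the set of variable-free terms built from constants $q\in Q$, unary symbols $s_\alpha$ and $\omega$-ary symbols $F_\alpha$ ($\alpha<\omega_1$), and $\omega$-ary symbols $F_q$ ($q\in Q$). To $u\in\mathbb T_\sigma$ associate a well founded labeled tree $T(u)=(T,t)$, $T\subseteq\omega^*$: for $u=q$ or $u=s_\alpha(v)$ it is the singleton tree $\{\varepsilon\}$ labeled by $u$; $T(F_q(u_0,u_1,\ldots))$ has root label $q$ and the subtree $T(u_i)$ at the node $i$, for each $i\ge 0$; $T(F_\alpha(u_0,u_1,\ldots))$ has root label $s_\alpha(u_0)$ and the subtree $T(u_{i+1})$ at the node $i$, for each $i\geq 0$. *Bases.* For a topological space $X$, $\mathbf\Sigma^0_1(X)$ is the class of open sets, $\mathbf\Sigma^0_2(X)$ the class of countable unions of differences of open sets, and, for $2<\alpha<\omega_1$, $\mathbf\Sigma^0_\alpha(X)$ is the class of countable unions of complements of sets from $\bigcup_{\beta<\alpha}\mathbf\Sigma^0_\beta(X)$ (with $\mathbf\Sigma^0_0(X)=\{\emptyset\}$).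 The Borel base of $X$ is $\mathcal L(X)=\{\mathcal L_\alpha(X)\}_{\alpha<\omega_1}$ with $\mathcal L_\alpha(X)=\mathbf\Sigma^0_{1+\alpha}(X)$. For any base (sequence of classes of subsets) $\mathcal L(X)=\{\mathcal L_\alpha(X)\}_{\alpha<\omega_1}$, its $\beta$-shift is $\mathcal L^\beta(X)=\{\mathcal L_{\beta+\alpha}(X)\}_{\alpha<\omega_1}$, and its restriction to $D\subseteq X$ is $\mathcal L(D)=\{\mathcal L_\alpha(D)\}_{\alpha<\omega_1}$ with $\mathcal L_\alpha(D)=\{D\cap S\mid S\in\mathcal L_\alpha(X)\}$. *Families.* By induction: a $q$-family in $\mathcal L(X)$ is $\{X\}$, and it determines only the constant function $A:X\to Q$ with value $q$; an $s_\alpha(u)$-family in $\mathcal L(X)$ is a $u$-family in $\mathcal L^{\omega^\alpha}(X)$, and it determines $A:X\to Q$ iff it does so as a $u$-family in $\mathcal L^{\omega^\alpha}(X)$; if $u$ is of the form $F_q(u_0,\ldots)$ or $F_\alpha(u_0,\ldots)$ and $(T,t)=T(u)$, a $u$-family in $\mathcal L(X)$ is a pair $(\{U_\tau\}_{\tau\in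 T},\{F_\tau\}_{\tau\in T})$ where $U_\tau\in\mathcal L_0(X)$, $U_\varepsilon=X$, $U_\tau\supseteq U_{\tau'}$ whenever $\tau'$ extends $\tau$, and each $F_\tau$ is a $t(\tau)$-family in $\mathcal L(\tilde U_\tau)$, where $\tilde U_\tau=U_\tau\setminus\bigcup\{U_{\tau'}\mid \tau'\in T\text{ properly extends }\tau\}$; it determines $A:X\to Q$ iff $F_\tau$ determines $A|_{\tilde U_\tau}$ for every $\tau\in T$. Let $\mathcal L(X,u)$ be the set of all $A:X\to Q$ determined by some $u$-family in the Borel base $\mathcal L(X)$, and let $\mathcal L^1(X,u)$ be defined in the same way from its $1$-shift $\mathcal L^1(X)$. *Principal total representations.* Let $\mathbf\Gamma$ assign to each space $X$ a set $\mathbf\Gamma(X)$ of functions $X\to Q$. A $\mathbf\Gamma$-TR of $\mathbf\Gamma(X)$ is a map $\nu:\mathcal N\to\mathbf\Gamma(X)$ such that the function $(a,x)\mapsto\nu(a)(x)$ belongs to $\mathbf\Gamma(\mathcal N\times X)$. It is a principal total representation of $\mathbf\Gamma(X)$ if moreover it is surjective and for every $\mathbf\Gamma$-TR $\mu:\mathcal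 N\to\mathbf\Gamma(X)$ there is a continuous $f:\mathcal N\to\mathcal N$ with $\mu=\nu\circ f$. **Theorem.** Let $X$ be a countably based $T_0$-space. Then for every $u\in\mathbb T_\sigma$ the level $\mathcal L^1(X,u)$ has a principal total representation (with respect to $\mathbf\Gamma=\mathcal L^1(\cdot,u)$). If $X$ is zero-dimensional, i.e. has a basis of clopen sets, then for every $u\in\mathbb T_\sigma$ the level $\mathcal L(X,u)$ has a principal total representation (with respect to $\mathbf\Gamma=\mathcal L(\cdot,u)$). -/

import Mathlib

namespace IFH

universe u v

/-- The Baire space: infinite sequences of natural numbers, with the product topology. -/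
abbrev Baire : Type := ℕ → ℕ

/-- The countable ordinals. -/
abbrev CountableOrdinal : Type 1 := {α : Ordinal.{0} // α < Ordinal.omega.{0} 1}

/-! ### Terms and their labeled trees -/

/-- Variable-free terms over the signature with a constant symbol for each `q : Q`, a unary symbol
`s_α` and an `ω`-ary symbol `F_α` for each countable ordinal `α`, and an `ω`-ary symbol `F_q` for
each `q : Q`. -/
inductive IFHTerm (Q : Type v) : Type (max 1 v)
  | const (q : Q) : IFHTerm Q
  | s (α : CountableOrdinal) (w : IFHTerm Q) : IFHTerm Q
  | Fconst (q : Q) (w : ℕ → IFHTerm Q) : IFHTerm Q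
  | Ford (α : CountableOrdinal) (w : ℕ → IFHTerm Q) : IFHTerm Q

namespace IFHTerm

variable {Q : Type v}

/-- The set of nodes of the tree `T(w)`: a singleton for constants and `s`-terms; the root below
which hang `T(w₀), T(w₁), …` for `F_q(w₀, w₁, …)`, and `T(w₁), T(w₂), …` for `F_α(w₀, w₁, …)`. -/
def tree : IFHTerm Q → Set (List ℕ)
  | const _ => {[]}
  | s _ _ => {[]}
  | Fconst _ w => {[]} ∪ {τ | ∃ i σ, τ = i :: σ ∧ σ ∈ tree (w i)}
  | Ford _ w => {[]} ∪ {τ | ∃ i σ, τ = i :: σ ∧ σ ∈ tree (w (i + 1))}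

/-- The labeling of `T(w)` by constants and `s`-terms; only its values at nodes of `T(w)` matter.
The root of `T(F_q(w₀, …))` has label `q`, the root of `T(F_α(w₀, …))` has label `s_α(w₀)`. -/
def label : IFHTerm Q → List ℕ → IFHTerm Q
  | const q, _ => const q
  | s α w, _ => s α w
  | Fconst q _, [] => const q
  | Fconst _ w, i :: σ => label (w i) σ
  | Ford α w, [] => s α (w 0)
  | Ford _ w, i :: σ => label (w (i + 1)) σ

end IFHTerm

/-! ### Borel hierarchy and hierarchy bases -/

/-- `BorelSigma α A` says that `A` is a `Σ⁰_α` subset of the topological space `X`: `Σ⁰_0` consists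
of the empty set, `Σ⁰_1` of the open sets, `Σ⁰_2` of the countable unions of differences of open
sets, and `Σ⁰_α` for `α > 2` of the countable unions of complements of sets of lower levels. -/
inductive BorelSigma {X : Type u} [TopologicalSpace X] : Ordinal.{0} → Set X → Prop
  | zero : BorelSigma 0 ∅
  | one (U : Set X) (hU : IsOpen U) : BorelSigma 1 U
  | two (U V : ℕ → Set X) (hU : ∀ n, IsOpen (U n)) (hV : ∀ n, IsOpen (V n)) :
      BorelSigma 2 (⋃ n, U n \ V n)
  | higher (α : Ordinal.{0}) (hα : 2 < α) (β : ℕ → Ordinal.{0}) (hβ : ∀ n, β n < α)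
      (A : ℕ → Set X) (hA : ∀ n, BorelSigma (β n) (A n)) : BorelSigma α (⋃ n, (A n)ᶜ)

/-- The data of a hierarchy base in a subset `carrier` of `X`: a transfinite sequence of classes of
subsets of `carrier`. Only the levels below `ω₁` are ever used, and the only instances used are
obtained from the Borel base by shifts and restrictions. -/
structure Base (X : Type u) where
  carrier : Set X
  level : Ordinal.{0} → Set (Set X)

namespace Base

variable {X : Type u}

/-- The `β`-shift of a base. -/
def shift (L : Base X) (β : Ordinal.{0}) : Base X where
  carrier := L.carrier
  level α := L.level (β + α)

/-- The restriction of a base to a subset of its carrier. -/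
def restrict (L : Base X) (D : Set X) : Base X where
  carrier := D
  level α := {B | ∃ S ∈ L.level α, B = D ∩ S}

end Base

/-- The Borel base `{Σ⁰_{1+α}(X)}_α` in `X`. -/
def borelBase (X : Type u) [TopologicalSpace X] : Base X where
  carrier := Set.univ
  level α := {A | BorelSigma (1 + α) A}

/-! ### Iterated families and the partitions they determine -/

section Families

variable {X : Type u} {Q : Type v}

/-- The component `Ũ_τ = U_τ \ ⋃ {U_τ' | τ ⊏ τ' ∈ T}` of a `T`-family `U`. -/
def component (T : Set (List ℕ)) (U : List ℕ → Set X) (τ : List ℕ) : Set X :=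
  U τ \ ⋃ τ' ∈ {τ' | τ' ∈ T ∧ τ <+: τ' ∧ τ ≠ τ'}, U τ'

/-- `U` is a monotone `T`-family of sets of level zero of the base `L`, with the whole carrier at
the root. Only the values of `U` at nodes of `T` matter. -/
structure IsMonotoneFamily (L : Base X) (T : Set (List ℕ)) (U : List ℕ → Set X) : Prop where
  mem_level : ∀ τ ∈ T, U τ ∈ L.level 0
  mono : ∀ τ ∈ T, ∀ τ' ∈ T, τ <+: τ' → U τ' ⊆ U τ
  root : U [] = L.carrier

/-- Raw iterated families of subsets of `X`: either `{D}`, or `({U_τ}, {F_τ})` where the `U_τ` are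
sets and the `F_τ` are iterated families again. -/
inductive Fam (X : Type u) : Type u
  | single (D : Set X) : Fam X
  | node (U : List ℕ → Set X) (F : List ℕ → Fam X) : Fam X

/-- `IsFamily L w F` says that `F` is a `w`-family in the base `L`. -/
inductive IsFamily : Base X → IFHTerm Q → Fam X → Prop
  | const (L : Base X) (q : Q) : IsFamily L (.const q) (.single L.carrier)
  | s (L : Base X) (α : CountableOrdinal) (w : IFHTerm Q) (F : Fam X)
      (h : IsFamily (L.shift (Ordinal.omega0 ^ α.1)) w F) : IsFamily L (.s α w) F
  | Fconst (L : Base X) (q : Q) (w : ℕ → IFHTerm Q) (U : List ℕ → Set X) (F : List ℕ → Fam X)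
      (hU : IsMonotoneFamily L (IFHTerm.Fconst q w).tree U)
      (hF : ∀ τ ∈ (IFHTerm.Fconst q w).tree,
        IsFamily (L.restrict (component (IFHTerm.Fconst q w).tree U τ))
          ((IFHTerm.Fconst q w).label τ) (F τ)) :
      IsFamily L (.Fconst q w) (.node U F)
  | Ford (L : Base X) (α : CountableOrdinal) (w : ℕ → IFHTerm Q) (U : List ℕ → Set X)
      (F : List ℕ → Fam X)
      (hU : IsMonotoneFamily L (IFHTerm.Ford α w).tree U)
      (hF : ∀ τ ∈ (IFHTerm.Ford α w).tree,
        IsFamily (L.restrict (component (IFHTerm.Ford α w).tree U τ))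
          ((IFHTerm.Ford α w).label τ) (F τ)) :
      IsFamily L (.Ford α w) (.node U F)

/-- `Determines L w F A` says that the `w`-family `F` in the base `L` determines the restriction of
`A` to the carrier of `L`. -/
inductive Determines : Base X → IFHTerm Q → Fam X → (X → Q) → Prop
  | const (L : Base X) (q : Q) (F : Fam X) (A : X → Q) (h : ∀ x ∈ L.carrier, A x = q) :
      Determines L (.const q) F A
  | s (L : Base X) (α : CountableOrdinal) (w : IFHTerm Q) (F : Fam X) (A : X → Q)
      (h : Determines (L.shift (Ordinal.omega0 ^ α.1)) w F A) : Determines L (.s α w) F A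
  | Fconst (L : Base X) (q : Q) (w : ℕ → IFHTerm Q) (U : List ℕ → Set X) (F : List ℕ → Fam X)
      (A : X → Q)
      (h : ∀ τ ∈ (IFHTerm.Fconst q w).tree,
        Determines (L.restrict (component (IFHTerm.Fconst q w).tree U τ))
          ((IFHTerm.Fconst q w).label τ) (F τ) A) :
      Determines L (.Fconst q w) (.node U F) A
  | Ford (L : Base X) (α : CountableOrdinal) (w : ℕ → IFHTerm Q) (U : List ℕ → Set X)
      (F : List ℕ → Fam X) (A : X → Q)
      (h : ∀ τ ∈ (IFHTerm.Ford α w).tree,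
        Determines (L.restrict (component (IFHTerm.Ford α w).tree U τ))
          ((IFHTerm.Ford α w).label τ) (F τ) A) :
      Determines L (.Ford α w) (.node U F) A

/-- The level `L(X, w)` of the infinitary fine hierarchy over a base `L` with carrier `X`. -/
def ifhLevel (L : Base X) (w : IFHTerm Q) : Set (X → Q) :=
  {A | ∃ F : Fam X, IsFamily L w F ∧ Determines L w F A}

end Families

/-- The assignment of a class of `Q`-partitions to every topological space. -/
abbrev PartitionClass (Q : Type v) : Type (max (u + 1) v) :=
  ∀ (Y : Type u) [TopologicalSpace Y], Set (Y → Q)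

/-- The levels `L(Y, w)` over the Borel bases in all spaces `Y`. -/
def borelIFH {Q : Type v} (w : IFHTerm Q) : PartitionClass.{u} Q :=
  fun Y _ => ifhLevel (borelBase Y) w

/-- The levels `L¹(Y, w)` over the 1-shifts of the Borel bases in all spaces `Y`. -/
def borelIFHShiftOne {Q : Type v} (w : IFHTerm Q) : PartitionClass.{u} Q :=
  fun Y _ => ifhLevel ((borelBase Y).shift 1) w

/-! ### Principal total representations -/

section Representations

variable {Q : Type v} (Γ : PartitionClass.{u} Q) (X : Type u) [TopologicalSpace X]

/-- `ν : 𝒩 → Γ(X)` is a `Γ`-TR: its universal `Q`-partition `(a, x) ↦ ν(a)(x)` is in `Γ(𝒩 × X)`. -/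
def IsTR (ν : Baire → Γ X) : Prop :=
  (fun p : Baire × X => (ν p.1 : X → Q) p.2) ∈ Γ (Baire × X)

/-- `ν` is a principal `Γ`-TR of `Γ(X)`: it is a surjective `Γ`-TR to which every `Γ`-TR `μ`
(surjective or not) is continuously reducible. -/
structure IsPrincipalTR (ν : Baire → Γ X) : Prop where
  surjective : Function.Surjective ν
  isTR : IsTR Γ X ν
  reducible : ∀ μ : Baire → Γ X, IsTR Γ X μ → ∃ f : Baire → Baire, Continuous f ∧ μ = ν ∘ f

end Representations

end IFH

open TopologicalSpace

namespace IFH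

universe u v

/-! ### The Borel hierarchy -/

section Borel

variable {X Y : Type u} [TopologicalSpace X] [TopologicalSpace Y] {α β : Ordinal.{0}}

/-! A principal total representation comes from a universal partition `v` of `Baire × X`: one that
lies in the class itself and to which every partition in the class reduces by a continuous change of
the Baire coordinate. Then `ν a = v (a, ·)` is a TR. It is surjective because a partition of `X`
pulls back to `Baire × X`, and principal because the partition of any TR is itself reducible to `v`.

To build `v` by induction on the term, the tree-indexed families are first replaced by a recursive
description, `DeterminedOn` (`exists_familyDetermines_iff`). Restrictions and shifts of the Borel
base compose, so only a subset `D` and an ordinal `γ` have to be remembered. At an `ω`-ary symbol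
the data are arbitrary `Σ⁰_{1+γ}` sets `S i`, the term `w i` or `w (i + 1)` being used on `D ∩ S i`
and the root label on the rest of `D`.

A universal partition for such a term is glued from those of its subterms along a universal sequence
of sets, which must be disjoint for the glued function to be well defined
(`exists_isUniversalPartition_gluedOn`). Disjointness comes from the reduction property of
`Σ⁰_{1+γ}`. This holds in every space if `1 ≤ γ`, and for open sets of a second countable
zero-dimensional space. Hence the two cases of the theorem. -/

theorem borelSigma_zero_iff {S : Set X} : BorelSigma 0 S ↔ S = ∅ := by
  constructor
  · intro h
    generalize hα : (0 : Ordinal.{0}) = α at h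
    cases h with
    | zero => rfl
    | one => simp at hα
    | two => simp at hα
    | higher _ h => simp [← hα] at h
  · rintro rfl
    exact .zero

theorem borelSigma_one_iff {S : Set X} : BorelSigma 1 S ↔ IsOpen S := by
  constructor
  · intro h
    generalize hα : (1 : Ordinal.{0}) = α at h
    cases h with
    | zero => simp at hα
    | one _ h => exact h
    | two => norm_num at hα
    | higher _ h => rw [← hα] at h; exact absurd h (by norm_num)
  · exact .one S

theorem borelSigma_two_iff {S : Set X} : BorelSigma 2 S ↔ ∃ U V : ℕ → Set X,
    (∀ n, IsOpen (U n)) ∧ (∀ n, IsOpen (V n)) ∧ S = ⋃ n, U n \ V n := by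
  constructor
  · intro h
    generalize hα : (2 : Ordinal.{0}) = α at h
    cases h with
    | zero => simp at hα
    | one => norm_num at hα
    | two U V hU hV => exact ⟨U, V, hU, hV, rfl⟩
    | higher _ h => exact absurd hα h.ne
  · rintro ⟨U, V, hU, hV, rfl⟩
    exact .two U V hU hV

theorem borelSigma_iff_of_two_lt (hα : 2 < α) {S : Set X} : BorelSigma α S ↔
    ∃ (β : ℕ → Ordinal.{0}) (A : ℕ → Set X), (∀ n, β n < α) ∧ (∀ n, BorelSigma (β n) (A n)) ∧
      S = ⋃ n, (A n)ᶜ := by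
  constructor
  · intro h
    cases h with
    | zero => simp at hα
    | one => exact absurd hα (by norm_num)
    | two => exact absurd hα (lt_irrefl _)
    | higher _ _ β hβ A hA => exact ⟨β, A, hβ, hA, rfl⟩
  · rintro ⟨β, A, hβ, hA, rfl⟩
    exact .higher α hα β hβ A hA

theorem ordinal_cases_two (α : Ordinal.{0}) : α = 0 ∨ α = 1 ∨ α = 2 ∨ 2 < α := by
  rcases lt_trichotomy α 2 with h | h | h
  · have : α ≤ 1 := by
      rw [← Order.lt_add_one_iff, one_add_one_eq_two]
      exact h
    rcases Order.le_one_iff.1 this with h | h <;> simp [h]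
  · simp [h]
  · simp [h]

namespace BorelSigma

theorem iUnion_nat {A : ℕ → Set X} (h : ∀ n, BorelSigma α (A n)) : BorelSigma α (⋃ n, A n) := by
  rcases ordinal_cases_two α with rfl | rfl | rfl | hα
  · simp only [borelSigma_zero_iff] at h ⊢
    simp [h]
  · simp only [borelSigma_one_iff] at h ⊢
    exact isOpen_iUnion h
  · simp only [borelSigma_two_iff] at h
    choose U V hU hV hA using h
    refine borelSigma_two_iff.2 ⟨fun k => U k.unpair.1 k.unpair.2, fun k => V k.unpair.1 k.unpair.2,
      fun k => hU _ _, fun k => hV _ _, ?_⟩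
    rw [Set.iUnion_unpair fun i j => U i j \ V i j]
    exact Set.iUnion_congr hA
  · simp only [borelSigma_iff_of_two_lt hα] at h
    choose β B hβ hB hA using h
    refine (borelSigma_iff_of_two_lt hα).2 ⟨fun k => β k.unpair.1 k.unpair.2,
      fun k => B k.unpair.1 k.unpair.2, fun k => hβ _ _, fun k => hB _ _, ?_⟩
    rw [Set.iUnion_unpair fun i j => (B i j)ᶜ]
    exact Set.iUnion_congr hA

theorem union {A B : Set X} (hA : BorelSigma α A) (hB : BorelSigma α B) :
    BorelSigma α (A ∪ B) := by
  have : A ∪ B = ⋃ n : ℕ, if n = 0 then A else B := by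
    ext x
    simp only [Set.mem_union, Set.mem_iUnion]
    constructor
    · rintro (h | h)
      · exact ⟨0, by simpa⟩
      · exact ⟨1, by simpa⟩
    · rintro ⟨n, h⟩
      split_ifs at h
      · exact .inl h
      · exact .inr h
  rw [this]
  refine iUnion_nat fun n => ?_
  split_ifs
  · exact hA
  · exact hB

theorem two_of_isOpen {U : Set X} (hU : IsOpen U) : BorelSigma 2 U :=
  borelSigma_two_iff.2 ⟨fun _ => U, fun _ => ∅, fun _ => hU, fun _ => isOpen_empty, by
    simp [Set.iUnion_const]⟩

theorem two_compl_of_isOpen {U : Set X} (hU : IsOpen U) : BorelSigma 2 Uᶜ :=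
  borelSigma_two_iff.2 ⟨fun _ => Set.univ, fun _ => U, fun _ => isOpen_univ, fun _ => hU, by
    simp [Set.iUnion_const, Set.compl_eq_univ_sdiff]⟩

/-- At level two, `U \ V` is the complement of `Uᶜ ∪ V`, which is again `Σ⁰_2` because open and
closed sets are both differences of open sets. Above level two the same representation serves for
the larger ordinal. -/
theorem mono_of_two_le (hα : 2 ≤ α) (h : α ≤ β) {S : Set X} (hS : BorelSigma α S) :
    BorelSigma β S := by
  rcases h.eq_or_lt with rfl | hlt
  · exact hS
  rcases hα.eq_or_lt with rfl | hα
  · obtain ⟨U, V, hU, hV, rfl⟩ := borelSigma_two_iff.1 hS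
    refine (borelSigma_iff_of_two_lt hlt).2 ⟨fun _ => 2, fun n => (U n)ᶜ ∪ V n, fun _ => hlt,
      fun n => (two_compl_of_isOpen (hU n)).union (two_of_isOpen (hV n)), ?_⟩
    simp [Set.sdiff_eq]
  · obtain ⟨δ, A, hδ, hA, rfl⟩ := (borelSigma_iff_of_two_lt hα).1 hS
    exact .higher β (hα.trans hlt) δ (fun n => (hδ n).trans hlt) A hA

theorem of_isOpen (hα : 1 ≤ α) {U : Set X} (hU : IsOpen U) : BorelSigma α U := by
  rcases ordinal_cases_two α with rfl | rfl | rfl | h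
  · simp at hα
  · exact .one U hU
  · exact two_of_isOpen hU
  · exact mono_of_two_le le_rfl h.le (two_of_isOpen hU)

theorem empty (α : Ordinal.{0}) : BorelSigma α (∅ : Set X) := by
  rcases eq_or_ne α 0 with rfl | h
  · exact .zero
  · exact of_isOpen (Order.one_le_iff_ne_zero.2 h) isOpen_empty

theorem mono (h : α ≤ β) {S : Set X} (hS : BorelSigma α S) : BorelSigma β S := by
  rcases ordinal_cases_two α with rfl | rfl | rfl | hα
  · rw [borelSigma_zero_iff.1 hS]
    exact empty β
  · exact of_isOpen h (borelSigma_one_iff.1 hS)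
  · exact mono_of_two_le le_rfl h hS
  · exact mono_of_two_le hα.le h hS

theorem compl (hβ : 2 ≤ β) (h : α < β) {S : Set X} (hS : BorelSigma α S) : BorelSigma β Sᶜ := by
  rcases hβ.eq_or_lt with rfl | hβ
  · refine two_compl_of_isOpen (borelSigma_one_iff.1 (hS.mono ?_))
    rw [← Order.lt_add_one_iff, one_add_one_eq_two]
    exact h
  · exact (borelSigma_iff_of_two_lt hβ).2 ⟨fun _ => α, fun _ => S, fun _ => h, fun _ => hS, by
      simp [Set.iUnion_const]⟩

theorem inter {A B : Set X} (hA : BorelSigma α A) (hB : BorelSigma α B) :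
    BorelSigma α (A ∩ B) := by
  rcases ordinal_cases_two α with rfl | rfl | rfl | hα
  · simp only [borelSigma_zero_iff] at hA ⊢
    simp [hA]
  · simp only [borelSigma_one_iff] at hA hB ⊢
    exact hA.inter hB
  · obtain ⟨U, V, hU, hV, rfl⟩ := borelSigma_two_iff.1 hA
    obtain ⟨U', V', hU', hV', rfl⟩ := borelSigma_two_iff.1 hB
    rw [Set.iUnion_inter]
    refine iUnion_nat fun n => ?_
    rw [Set.inter_iUnion]
    refine borelSigma_two_iff.2 ⟨fun m => U n ∩ U' m, fun m => V n ∪ V' m,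
      fun m => (hU n).inter (hU' m), fun m => (hV n).union (hV' m), Set.iUnion_congr fun m => ?_⟩
    ext x
    simp only [Set.mem_inter_iff, Set.mem_sdiff, Set.mem_union]
    tauto
  · obtain ⟨δ, A, hδ, hA', rfl⟩ := (borelSigma_iff_of_two_lt hα).1 hA
    obtain ⟨δ', B, hδ', hB', rfl⟩ := (borelSigma_iff_of_two_lt hα).1 hB
    rw [Set.iUnion_inter]
    refine iUnion_nat fun n => ?_
    rw [Set.inter_iUnion]
    exact (borelSigma_iff_of_two_lt hα).2 ⟨fun m => max (δ n) (δ' m), fun m => A n ∪ B m,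
      fun m => max_lt (hδ n) (hδ' m),
      fun m => ((hA' n).mono (le_max_left _ _)).union ((hB' m).mono (le_max_right _ _)),
      Set.iUnion_congr fun m => (Set.compl_union _ _).symm⟩

theorem preimage {f : X → Y} (hf : Continuous f) {S : Set Y} (hS : BorelSigma α S) :
    BorelSigma α (f ⁻¹' S) := by
  induction hS with
  | zero => exact .zero
  | one U hU => exact .one _ (hU.preimage hf)
  | two U V hU hV =>
    simp only [Set.preimage_iUnion, Set.preimage_sdiff]
    exact .two _ _ (fun n => (hU n).preimage hf) fun n => (hV n).preimage hf
  | higher α hα β hβ A hA ih =>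
    simp only [Set.preimage_iUnion, Set.preimage_compl]
    exact .higher α hα β hβ _ ih

theorem diff (hα : 2 ≤ α) (h : β < α) {A B : Set X} (hA : BorelSigma β A) (hB : BorelSigma β B) :
    BorelSigma α (A \ B) :=
  (hA.mono h.le).inter (hB.compl hα h)

/-- A common normal form for level two and the levels above it, so that later arguments need not
separate them. -/
theorem exists_eq_iUnion_diff (hα : 2 ≤ α) {S : Set X} (hS : BorelSigma α S) :
    ∃ (β : ℕ → Ordinal.{0}) (A B : ℕ → Set X), (∀ n, β n < α) ∧ (∀ n, BorelSigma (β n) (A n)) ∧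
      (∀ n, BorelSigma (β n) (B n)) ∧ S = ⋃ n, A n \ B n := by
  rcases hα.eq_or_lt with rfl | hα
  · obtain ⟨U, V, hU, hV, rfl⟩ := borelSigma_two_iff.1 hS
    exact ⟨fun _ => 1, U, V, fun _ => by norm_num, fun n => .one _ (hU n), fun n => .one _ (hV n),
      rfl⟩
  · obtain ⟨β, A, hβ, hA, rfl⟩ := (borelSigma_iff_of_two_lt hα).1 hS
    -- The maximum with `1` is needed because the whole space need not be `Σ⁰_0`.
    refine ⟨fun n => max 1 (β n), fun _ => Set.univ, A,
      fun n => max_lt (lt_trans (by norm_num) hα) (hβ n),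
      fun n => of_isOpen (le_max_left _ _) isOpen_univ, fun n => (hA n).mono (le_max_right _ _), ?_⟩
    simp [Set.compl_eq_univ_sdiff]

end BorelSigma

/-! ### The reduction property -/

/-- Every `Σ⁰_α` subset of `X` is a countable union of sets which are `Σ⁰_α` together with their
complements. -/
def HasAmbiguousCovers (α : Ordinal.{0}) (X : Type u) [TopologicalSpace X] : Prop :=
  ∀ S : Set X, BorelSigma α S → ∃ C : ℕ → Set X, S = ⋃ n, C n ∧
    ∀ n, BorelSigma α (C n) ∧ BorelSigma α (C n)ᶜ

/-- The pieces `A n \ B n` have complements `(A n)ᶜ ∪ B n`, which are `Σ⁰_α` since `A n` and `B n`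
are of lower level. -/
theorem hasAmbiguousCovers_of_two_le (hα : 2 ≤ α) : HasAmbiguousCovers α X := by
  intro S hS
  obtain ⟨β, A, B, hβ, hA, hB, rfl⟩ := hS.exists_eq_iUnion_diff hα
  refine ⟨fun n => A n \ B n, rfl, fun n => ⟨(hA n).diff hα (hβ n) (hB n), ?_⟩⟩
  simp only [Set.sdiff_eq, Set.compl_inter, compl_compl]
  exact ((hA n).compl hα (hβ n)).union ((hB n).mono (hβ n).le)

theorem hasAmbiguousCovers_one [SecondCountableTopology X]
    (hX : IsTopologicalBasis {s : Set X | IsClopen s}) : HasAmbiguousCovers 1 X := by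
  intro S hS
  obtain ⟨b, hb, hbc, hbas⟩ := hX.exists_countable
  obtain ⟨C, hC⟩ := (((hbc.mono (Set.sep_subset b (· ⊆ S)))).insert ∅).exists_eq_range
    (Set.insert_nonempty _ _)
  have hclopen : ∀ n, IsClopen (C n) := fun n => by
    have : C n ∈ insert ∅ {s ∈ b | s ⊆ S} := hC ▸ Set.mem_range_self n
    rcases this with h | h
    · rw [h]
      exact isClopen_empty
    · exact hb h.1
  refine ⟨C, ?_, fun n => ⟨.one _ (hclopen n).isOpen, .one _ (hclopen n).compl.isOpen⟩⟩
  rw [← Set.sUnion_range, ← hC, Set.sUnion_insert, Set.empty_union]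
  exact hbas.open_eq_sUnion' (borelSigma_one_iff.1 hS)

/-- All ambiguous pieces of all `S i` are listed in one sequence and made disjoint. Each step
removes finitely many sets with `Σ⁰_α` complements, so the level is kept. `R i` collects what
remains of the pieces of `S i`. -/
theorem HasAmbiguousCovers.reduction (hX : HasAmbiguousCovers α X) {S : ℕ → Set X}
    (hS : ∀ i, BorelSigma α (S i)) : ∃ R : ℕ → Set X, (∀ i, BorelSigma α (R i)) ∧
      (∀ i, R i ⊆ S i) ∧ Pairwise (Function.onFun Disjoint R) ∧ ⋃ i, R i = ⋃ i, S i := by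
  choose C hSC hC using fun i => hX (S i) (hS i)
  let E : ℕ → Set X := fun k => C k.unpair.1 k.unpair.2
  have hE : ∀ k, BorelSigma α (disjointed E k) := fun k =>
    disjointedRec (fun _ _ ht => ht.inter (hC _ _).2) (hC _ _).1
  refine ⟨fun i => ⋃ n, disjointed E (Nat.pair i n), fun i => .iUnion_nat fun n => hE _, ?_, ?_, ?_⟩
  · intro i
    refine Set.iUnion_subset fun n => (disjointed_subset E _).trans ?_
    rw [hSC i]
    simpa [E] using Set.subset_iUnion (C i) n
  · intro i j hij
    simp only [Function.onFun, Set.disjoint_iUnion_left, Set.disjoint_iUnion_right]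
    exact fun n m => disjoint_disjointed E fun h => hij (Nat.pair_eq_pair.1 h).1
  · calc ⋃ i, ⋃ n, disjointed E (Nat.pair i n)
        = ⋃ k, disjointed E k := by
          rw [← Set.iUnion_unpair fun i n => disjointed E (Nat.pair i n)]
          simp
      _ = ⋃ k, E k := iUnion_disjointed
      _ = ⋃ i, ⋃ n, C i n := Set.iUnion_unpair C
      _ = ⋃ i, S i := by simp [← hSC]

end Borel

/-! ### Sequences of points of the Baire space -/

namespace Baire

/-- The `i`-th member of the sequence coded by `b`. -/
def proj (i : ℕ) (b : Baire) : Baire := fun n => b (Nat.pair i n)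

/-- The code of a sequence of points of the Baire space. -/
def combine (h : ℕ → Baire) : Baire := fun k => h k.unpair.1 k.unpair.2

@[simp]
theorem proj_combine (i : ℕ) (h : ℕ → Baire) : proj i (combine h) = h i := by
  funext n
  simp [proj, combine]

theorem continuous_proj (i : ℕ) : Continuous (proj i) :=
  continuous_pi fun _ => continuous_apply _

theorem continuous_combine {Z : Type*} [TopologicalSpace Z] {h : ℕ → Z → Baire}
    (hh : ∀ i, Continuous (h i)) : Continuous fun z => combine fun i => h i z :=
  continuous_pi fun _ => (continuous_apply _).comp (hh _)

theorem continuous_of_cylinder {g : Baire → Baire} (N : ℕ → ℕ)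
    (hg : ∀ m a a', PiNat.cylinder a (N m) = PiNat.cylinder a' (N m) → g a m = g a' m) :
    Continuous g := by
  refine continuous_pi fun m => (IsLocallyConstant.iff_exists_open _).2 (fun a => ?_) |>.continuous
  refine ⟨PiNat.cylinder a (N m), PiNat.isOpen_cylinder _ a _, PiNat.self_mem_cylinder a _, ?_⟩
  exact fun a' ha' => hg m a' a (PiNat.mem_cylinder_iff_eq.1 ha')

theorem isTopologicalBasis_isClopen : IsTopologicalBasis {s : Set Baire | IsClopen s} := by
  refine isTopologicalBasis_of_isOpen_of_nhds (fun s hs => hs.isOpen) fun a U ha hU => ?_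
  obtain ⟨_, ⟨b, n, rfl⟩, hab, hbU⟩ :=
    (PiNat.isTopologicalBasis_cylinders fun _ => ℕ).exists_subset_of_mem_open ha hU
  refine ⟨_, ⟨?_, PiNat.isOpen_cylinder _ b n⟩, hab, hbU⟩
  rw [PiNat.cylinder_eq_pi]
  exact isClosed_set_pi fun i _ => isClosed_discrete _

end Baire

open Baire

/-! ### Universal sets -/

section Universal

variable {X : Type u} [TopologicalSpace X] {α β : Ordinal.{0}}

/-- The map of `Baire × X` to itself which acts by `g` on the first component. -/
def onCode (g : Baire → Baire) (p : Baire × X) : Baire × X := (g p.1, p.2)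

theorem continuous_onCode {g : Baire → Baire} (hg : Continuous g) :
    Continuous (onCode (X := X) g) :=
  (hg.comp continuous_fst).prodMk continuous_snd

/-- `W` is a `Σ⁰_α` subset of `Baire × X` to which all others are reducible by continuous
transformations of the first component. -/
def IsUniversal (α : Ordinal.{0}) (W : Set (Baire × X)) : Prop :=
  BorelSigma α W ∧ ∀ S, BorelSigma α S → ∃ g, Continuous g ∧ S = onCode g ⁻¹' W

theorem exists_isUniversal_one [SecondCountableTopology X] :
    ∃ W : Set (Baire × X), IsUniversal 1 W := by
  classical
  obtain ⟨B, hB⟩ := ((countable_countableBasis X).insert ∅).exists_eq_range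
    (Set.insert_nonempty _ _)
  have hBo : ∀ n, IsOpen (B n) := fun n => by
    have : B n ∈ insert ∅ (countableBasis X) := hB ▸ Set.mem_range_self n
    rcases this with h | h
    · rw [h]
      exact isOpen_empty
    · exact isOpen_of_mem_countableBasis h
  obtain ⟨z, hz⟩ : ∃ z, B z = ∅ := by
    have : ∅ ∈ Set.range B := hB ▸ Set.mem_insert _ _
    exact this
  -- A code lists indices of basic open sets, and its section is their union.
  refine ⟨{p | ∃ n, p.2 ∈ B (p.1 n)}, .one _ ?_, fun S hS => ?_⟩
  · have : {p : Baire × X | ∃ n, p.2 ∈ B (p.1 n)} =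
        ⋃ n, ⋃ k, (fun p : Baire × X => p.1 n) ⁻¹' {k} ∩ Prod.snd ⁻¹' B k := by
      ext p
      simp
    rw [this]
    exact isOpen_iUnion fun n => isOpen_iUnion fun k =>
      ((isOpen_discrete {k}).preimage ((continuous_apply n).comp continuous_fst)).inter
        ((hBo k).preimage continuous_snd)
  -- Entry `⟨n, k⟩` of the new code lists `B k` if the box over the first `n` terms of `a` lies in
  -- `S`, and otherwise the empty set `B z`. It depends on those `n` terms only, whence continuity.
  · let g : Baire → Baire := fun a m =>
      if PiNat.cylinder a m.unpair.1 ×ˢ B m.unpair.2 ⊆ S then m.unpair.2 else z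
    refine ⟨g, continuous_of_cylinder (fun m => m.unpair.1) fun m a a' h => by simp only [g, h], ?_⟩
    ext ⟨a, x⟩
    constructor
    · intro h
      obtain ⟨U, V, hU, hV, ha, hx, hUV⟩ := isOpen_prod_iff.1 (borelSigma_one_iff.1 hS) a x h
      obtain ⟨_, ⟨b, n, rfl⟩, hab, hbU⟩ :=
        (PiNat.isTopologicalBasis_cylinders fun _ => ℕ).exists_subset_of_mem_open ha hU
      rw [← PiNat.mem_cylinder_iff_eq.1 hab] at hbU
      obtain ⟨C, hC, hxC, hCV⟩ := (isBasis_countableBasis X).exists_subset_of_mem_open hx hV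
      obtain ⟨k, rfl⟩ : ∃ k, B k = C := by
        have : C ∈ Set.range B := hB ▸ Set.mem_insert_of_mem _ hC
        exact this
      refine ⟨Nat.pair n k, ?_⟩
      have : PiNat.cylinder a n ×ˢ B k ⊆ S := (Set.prod_mono hbU hCV).trans hUV
      simpa [onCode, g, this] using hxC
    · rintro ⟨m, hm⟩
      simp only [onCode, g] at hm
      split_ifs at hm with h
      · exact h ⟨PiNat.self_mem_cylinder a _, hm⟩
      · simp [hz] at hm

theorem countable_Iio_of_lt_omega_one (hα : α < Ordinal.omega.{0} 1) :
    Countable (Set.Iio α) := by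
  rw [← Cardinal.mk_le_aleph0_iff, Cardinal.mk_Iio_ordinal, Cardinal.lift_le_aleph0,
    ← Order.lt_succ_iff, Cardinal.succ_aleph0, ← Cardinal.lt_omega_iff_card_lt]
  exact hα

/-- Since `α` is countable, the lower levels can be enumerated, and a code can name for each `m` a
level and codes at that level for the two sets of the `m`-th difference. -/
theorem exists_isUniversal_of_two_le (h2 : 2 ≤ α) (hα : α < Ordinal.omega.{0} 1)
    (ih : ∀ β < α, ∃ W : Set (Baire × X), IsUniversal β W) :
    ∃ W : Set (Baire × X), IsUniversal α W := by
  have : Countable (Set.Iio α) := countable_Iio_of_lt_omega_one hα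
  have h1 : 1 ≤ α := le_trans (by norm_num) h2
  have : Nonempty (Set.Iio α) := ⟨⟨0, Set.mem_Iio.2 (zero_lt_one.trans_le h1)⟩⟩
  obtain ⟨e, he⟩ := exists_surjective_nat (Set.Iio α)
  choose W hW hWu using fun n => ih (e n) (e n).2
  have hc : ∀ m i : ℕ, Continuous fun b : Baire => proj i (proj m b) := fun m i =>
    (continuous_proj i).comp (continuous_proj m)
  -- In the `m`-th part of the code, component `0` holds the index of the level in its first entry,
  -- and components `1` and `2` code the minuend and the subtrahend.
  refine ⟨⋃ m, ⋃ n, (fun p : Baire × X => proj 0 (proj m p.1) 0) ⁻¹' {n} ∩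
    (onCode (fun b => proj 1 (proj m b)) ⁻¹' W n \ onCode (fun b => proj 2 (proj m b)) ⁻¹' W n),
    .iUnion_nat fun m => .iUnion_nat fun n => ?_, fun S hS => ?_⟩
  · refine .inter (.of_isOpen h1 ?_) (.diff h2 (e n).2 ?_ ?_)
    · exact (isOpen_discrete {n}).preimage
        ((continuous_apply 0).comp ((hc m 0).comp continuous_fst))
    · exact (hW n).preimage (continuous_onCode (hc m 1))
    · exact (hW n).preimage (continuous_onCode (hc m 2))
  · obtain ⟨β, A, B, hβ, hA, hB, rfl⟩ := hS.exists_eq_iUnion_diff h2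
    choose n hn using fun m => he ⟨β m, hβ m⟩
    have hn' : ∀ m, (e (n m) : Ordinal.{0}) = β m := fun m => congrArg Subtype.val (hn m)
    choose gA hgA hAg using fun m => hWu (n m) (A m) (hn' m ▸ hA m)
    choose gB hgB hBg using fun m => hWu (n m) (B m) (hn' m ▸ hB m)
    let h : ℕ → ℕ → Baire → Baire := fun m i => match i with
      | 0 => fun _ _ => n m
      | 1 => gA m
      | _ => gB m
    have hh : ∀ m i, Continuous (h m i) := fun m i => match i with
      | 0 => continuous_const
      | 1 => hgA m
      | _ + 2 => hgB m
    refine ⟨fun a => combine fun m => combine fun i => h m i a,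
      continuous_combine fun m => continuous_combine (hh m), ?_⟩
    ext p
    have h1 : ∀ m, p ∈ A m ↔ onCode (gA m) p ∈ W (n m) := fun m => by
      rw [← Set.mem_preimage, ← hAg m]
    have h2 : ∀ m, p ∈ B m ↔ onCode (gB m) p ∈ W (n m) := fun m => by
      rw [← Set.mem_preimage, ← hBg m]
    simp only [Set.mem_iUnion, Set.mem_sdiff, h1, h2, Set.mem_preimage, Set.mem_inter_iff,
      Set.mem_singleton_iff, onCode, proj_combine, h, exists_eq_left']

theorem exists_isUniversal [SecondCountableTopology X] (hα : α < Ordinal.omega.{0} 1) :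
    ∃ W : Set (Baire × X), IsUniversal α W := by
  induction α using WellFoundedLT.induction with
  | ind α ih =>
    rcases lt_or_ge α 2 with h | h
    · rcases ordinal_cases_two α with rfl | rfl | rfl | h'
      · refine ⟨∅, .zero, fun S hS => ⟨id, continuous_id, ?_⟩⟩
        rw [borelSigma_zero_iff.1 hS, Set.preimage_empty]
      · exact exists_isUniversal_one
      · exact absurd h (lt_irrefl _)
      · exact absurd h h'.not_gt
    · exact exists_isUniversal_of_two_le h hα fun β hβ => ih β hβ (hβ.trans hα)

/-- There is a disjoint sequence of `Σ⁰_α` subsets of `Baire × X` to which all others are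
reducible. -/
theorem exists_universal_disjoint_sequence [SecondCountableTopology X]
    (hα : α < Ordinal.omega.{0} 1) (hX : HasAmbiguousCovers α (Baire × X)) :
    ∃ V : ℕ → Set (Baire × X), (∀ i, BorelSigma α (V i)) ∧ Pairwise (Function.onFun Disjoint V) ∧
      ∀ S : ℕ → Set (Baire × X), (∀ i, BorelSigma α (S i)) →
        Pairwise (Function.onFun Disjoint S) →
        ∃ g, Continuous g ∧ ∀ i, S i = onCode g ⁻¹' V i := by
  obtain ⟨W, hW, hWu⟩ := exists_isUniversal (X := X) hα
  -- The components of a code give a universal sequence for `W`, which reduction makes disjoint.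
  obtain ⟨V, hV, hVW, hdisj, hunion⟩ :=
    hX.reduction fun i => hW.preimage (continuous_onCode (continuous_proj i))
  refine ⟨V, hV, hdisj, fun S hS hSd => ?_⟩
  choose g hg hSg using fun i => hWu (S i) (hS i)
  let G : Baire → Baire := fun a => combine fun i => g i a
  have hSG : ∀ i, S i = onCode G ⁻¹' (onCode (proj i) ⁻¹' W) := fun i => by
    rw [hSg i]
    ext p
    simp [onCode, G]
  have hsub : ∀ i, onCode G ⁻¹' V i ⊆ S i := fun i => by
    rw [hSG i]
    exact Set.preimage_mono (hVW i)
  -- Reduction loses nothing on a sequence that is already disjoint: a point of `S i` lies in the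
  -- preimage of some `V j`, hence in `S j`, which forces `i = j`.
  refine ⟨G, continuous_combine hg, fun i => Set.Subset.antisymm (fun p hp => ?_) (hsub i)⟩
  have : onCode G p ∈ ⋃ j, V j := by
    rw [hunion]
    rw [hSG i] at hp
    exact Set.mem_iUnion.2 ⟨i, hp⟩
  obtain ⟨j, hj⟩ := Set.mem_iUnion.1 this
  obtain rfl : i = j := by
    by_contra hij
    exact Set.disjoint_left.1 (hSd hij) hp (hsub j hj)
  exact hj

end Universal

/-! ### Universal partitions -/

section Glue

variable {X Y : Type u} [TopologicalSpace X] [TopologicalSpace Y] {Q : Type v}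
  {α : Ordinal.{0}}

/-- There are `Σ⁰_α` sets `S i` such that each `D ∩ S i` satisfies `R i`, and the rest of `D`
satisfies `R₀`. -/
def GluedOn (α : Ordinal.{0}) (R₀ : Set X → Prop) (R : ℕ → Set X → Prop) (D : Set X) : Prop :=
  ∃ S : ℕ → Set X, (∀ i, BorelSigma α (S i)) ∧ (∀ i, R i (D ∩ S i)) ∧ R₀ (D \ ⋃ i, S i)

theorem GluedOn.preimage {f : X → Y} (hf : Continuous f) {R₀ : Set Y → Prop}
    {R : ℕ → Set Y → Prop} {R₀' : Set X → Prop} {R' : ℕ → Set X → Prop} {D : Set Y}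
    (h : GluedOn α R₀ R D) (h₀ : ∀ B, R₀ B → R₀' (f ⁻¹' B))
    (hR : ∀ i B, R i B → R' i (f ⁻¹' B)) : GluedOn α R₀' R' (f ⁻¹' D) := by
  obtain ⟨S, hS, h1, h2⟩ := h
  refine ⟨fun i => f ⁻¹' S i, fun i => (hS i).preimage hf, fun i => hR i _ (h1 i), ?_⟩
  rw [← Set.preimage_iUnion, ← Set.preimage_sdiff]
  exact h₀ _ h2

/-- `DeterminedOn A w γ D` says that `A` restricted to `D` is determined by some `w`-family over
the restriction to `D` of the `γ`-shift of the Borel base, see `exists_determines_iff`. -/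
def DeterminedOn (A : X → Q) : IFHTerm Q → Ordinal.{0} → Set X → Prop
  | .const q, _, D => ∀ x ∈ D, A x = q
  | .s δ w, γ, D => DeterminedOn A w (γ + Ordinal.omega0 ^ δ.1) D
  | .Fconst q w, γ, D =>
      GluedOn (1 + γ) (fun B => ∀ x ∈ B, A x = q) (fun i => DeterminedOn A (w i) γ) D
  | .Ford δ w, γ, D =>
      GluedOn (1 + γ) (DeterminedOn A (w 0) (γ + Ordinal.omega0 ^ δ.1))
        (fun i => DeterminedOn A (w (i + 1)) γ) D

theorem DeterminedOn.mono_congr {A A' : X → Q} {w : IFHTerm Q} {γ : Ordinal.{0}} {D D' : Set X}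
    (h : DeterminedOn A w γ D) (hD : D' ⊆ D) (hA : ∀ x ∈ D', A x = A' x) :
    DeterminedOn A' w γ D' := by
  induction w generalizing γ D D' with
  | const q => exact fun x hx => (hA x hx).symm.trans (h x (hD hx))
  | s δ w ih => exact ih h hD hA
  | Fconst q w ih =>
    obtain ⟨S, hS, h1, h2⟩ := h
    exact ⟨S, hS, fun i => ih i (h1 i) (Set.inter_subset_inter_left _ hD) fun x hx => hA x hx.1,
      fun x hx => (hA x hx.1).symm.trans (h2 x ⟨hD hx.1, hx.2⟩)⟩
  | Ford δ w ih =>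
    obtain ⟨S, hS, h1, h2⟩ := h
    exact ⟨S, hS,
      fun i => ih _ (h1 i) (Set.inter_subset_inter_left _ hD) fun x hx => hA x hx.1,
      ih 0 h2 (Set.sdiff_subset_sdiff_left hD) fun x hx => hA x hx.1⟩

theorem DeterminedOn.preimage {A : Y → Q} {w : IFHTerm Q} {γ : Ordinal.{0}} {D : Set Y}
    (h : DeterminedOn A w γ D) {f : X → Y} (hf : Continuous f) :
    DeterminedOn (A ∘ f) w γ (f ⁻¹' D) := by
  induction w generalizing γ D with
  | const q => exact fun x hx => h _ hx
  | s δ w ih => exact ih h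
  | Fconst q w ih => exact GluedOn.preimage hf h (fun B hB x hx => hB _ hx) fun i B => ih i
  | Ford δ w ih => exact GluedOn.preimage hf h (fun B => ih 0) fun i B => ih _

/-- `v`, as a `Q`-partition of `Baire × X`, satisfies `R`, and every other partition satisfying
`R` on some set is reducible to it on that set. -/
structure IsUniversalPartition (R : (Baire × X → Q) → Set (Baire × X) → Prop)
    (v : Baire × X → Q) : Prop where
  univ : R v Set.univ
  reducible : ∀ A D, R A D → ∃ g, Continuous g ∧ ∀ p ∈ D, A p = v (onCode g p)

/-- `R` is stable under shrinking the set, changing the partition off the set, and continuous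
transformations of the first component. -/
structure IsStable (R : (Baire × X → Q) → Set (Baire × X) → Prop) : Prop where
  mono_congr : ∀ {A A' D D'}, R A D → D' ⊆ D → (∀ x ∈ D', A x = A' x) → R A' D'
  preimage : ∀ {A D g}, Continuous g → R A D → R (A ∘ onCode g) (onCode g ⁻¹' D)

theorem isStable_determinedOn (w : IFHTerm Q) (γ : Ordinal.{0}) :
    IsStable (X := X) fun A D => DeterminedOn A w γ D where
  mono_congr := DeterminedOn.mono_congr
  preimage hg h := h.preimage (continuous_onCode hg)

theorem exists_isUniversalPartition_gluedOn [SecondCountableTopology X]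
    (hα : α < Ordinal.omega.{0} 1) (hX : HasAmbiguousCovers α (Baire × X))
    {R₀ : (Baire × X → Q) → Set (Baire × X) → Prop}
    {R : ℕ → (Baire × X → Q) → Set (Baire × X) → Prop}
    (h₀ : IsStable R₀) (hR : ∀ i, IsStable (R i))
    (hv₀ : ∃ v, IsUniversalPartition R₀ v) (hv : ∀ i, ∃ v, IsUniversalPartition (R i) v) :
    ∃ v, IsUniversalPartition (fun A D => GluedOn α (R₀ A) (fun i => R i A) D) v := by
  classical
  obtain ⟨v₀, hv₀⟩ := hv₀
  choose v hv using hv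
  obtain ⟨V, hV, hVd, hVu⟩ := exists_universal_disjoint_sequence hα hX
  -- Component `0` of the code selects the piece, component `1` is the code for the remainder, and
  -- component `i + 2` the code for the `i`-th piece.
  let u : Baire × X → Q := fun p =>
    if h : ∃ i, onCode (proj 0) p ∈ V i then v h.choose (onCode (proj (h.choose + 2)) p)
    else v₀ (onCode (proj 1) p)
  have hu : ∀ p i, onCode (proj 0) p ∈ V i → u p = v i (onCode (proj (i + 2)) p) := by
    intro p i hi
    have h : ∃ i, onCode (proj 0) p ∈ V i := ⟨i, hi⟩
    have hii : h.choose = i := by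
      by_contra hne
      exact Set.disjoint_left.1 (hVd hne) h.choose_spec hi
    simp only [u, dif_pos h, hii]
  have hu₀ : ∀ p, (∀ i, onCode (proj 0) p ∉ V i) → u p = v₀ (onCode (proj 1) p) := by
    intro p hp
    have h : ¬∃ i, onCode (proj 0) p ∈ V i := fun ⟨i, hi⟩ => hp i hi
    simp only [u, dif_neg h]
  refine ⟨u, ⟨fun i => onCode (proj 0) ⁻¹' V i,
    fun i => (hV i).preimage (continuous_onCode (continuous_proj 0)), fun i => ?_, ?_⟩, ?_⟩
  · exact (hR i).mono_congr ((hR i).preimage (continuous_proj (i + 2)) (hv i).univ)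
      (Set.subset_univ _) fun p hp => (hu p i hp.2).symm
  · exact h₀.mono_congr (h₀.preimage (continuous_proj 1) hv₀.univ)
      (Set.subset_univ _) fun p hp => (hu₀ p fun i hi => hp.2 (Set.mem_iUnion.2 ⟨i, hi⟩)).symm
  · rintro A D ⟨S, hS, h1, h2⟩
    -- The given `S i` may overlap. Shrinking them to disjoint `S' i` is harmless, since `R i`
    -- passes to subsets and the union, hence the remainder, is unchanged.
    obtain ⟨S', hS', hsub, hdisj, hunion⟩ := hX.reduction hS
    obtain ⟨g, hg, hSg⟩ := hVu S' hS' hdisj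
    choose f hf hAf using fun i => (hv i).reducible A (D ∩ S' i)
      ((hR i).mono_congr (h1 i) (Set.inter_subset_inter_right _ (hsub i)) fun _ _ => rfl)
    obtain ⟨f₀, hf₀, hAf₀⟩ := hv₀.reducible A _ h2
    let F : ℕ → Baire → Baire := fun i => match i with
      | 0 => g
      | 1 => f₀
      | i + 2 => f i
    have hF : ∀ i, Continuous (F i) := fun i => match i with
      | 0 => hg
      | 1 => hf₀
      | i + 2 => hf i
    have hproj : ∀ i (p : Baire × X),
        onCode (proj i) (onCode (fun a => combine fun i => F i a) p) = onCode (F i) p :=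
      fun i p => by simp [onCode]
    refine ⟨fun a => combine fun i => F i a, continuous_combine hF, fun p hp => ?_⟩
    by_cases h : ∃ i, p ∈ S' i
    · obtain ⟨i, hi⟩ := h
      rw [hu _ i, hproj, hAf i p ⟨hp, hi⟩]
      rw [hproj]
      rw [hSg i] at hi
      exact hi
    · rw [hu₀, hproj, hAf₀ p ⟨hp, ?_⟩]
      · rw [← hunion]
        simpa using h
      · intro i hi
        rw [hproj] at hi
        exact h ⟨i, by rw [hSg i]; exact hi⟩

theorem add_lt_omega_one {γ δ : Ordinal.{0}} (hγ : γ < Ordinal.omega.{0} 1)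
    (hδ : δ < Ordinal.omega.{0} 1) : γ + δ < Ordinal.omega.{0} 1 := by
  rw [Cardinal.lt_omega_iff_card_lt] at *
  rw [Ordinal.card_add]
  exact Cardinal.add_lt_of_lt (Cardinal.aleph0_le_aleph 1) hγ hδ

theorem omega0_opow_lt_omega_one {δ : Ordinal.{0}} (hδ : δ < Ordinal.omega.{0} 1) :
    Ordinal.omega0 ^ δ < Ordinal.omega.{0} 1 :=
  Ordinal.isPrincipal_opow_omega 1 Ordinal.omega0_lt_omega_one hδ

theorem exists_isUniversalPartition_determinedOn [SecondCountableTopology X] (w : IFHTerm Q)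
    {γ : Ordinal.{0}} (hγ : γ < Ordinal.omega.{0} 1)
    (hX : 1 ≤ γ ∨ IsTopologicalBasis {s : Set X | IsClopen s}) :
    ∃ v : Baire × X → Q, IsUniversalPartition (fun A D => DeterminedOn A w γ D) v := by
  -- As `1 ≤ ω ^ δ`, every shift leads to the case `1 ≤ γ`, where no assumption on the space is
  -- needed.
  have hshift : ∀ {γ : Ordinal.{0}} (δ : CountableOrdinal), γ < Ordinal.omega.{0} 1 →
      γ + Ordinal.omega0 ^ δ.1 < Ordinal.omega.{0} 1 ∧ 1 ≤ γ + Ordinal.omega0 ^ δ.1 := by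
    intro γ δ hγ
    refine ⟨add_lt_omega_one hγ (omega0_opow_lt_omega_one δ.2), le_add_left ?_⟩
    exact Order.one_le_iff_ne_zero.2 (Ordinal.opow_pos _ Ordinal.omega0_pos).ne'
  have hcovers : ∀ {γ : Ordinal.{0}}, (1 ≤ γ ∨ IsTopologicalBasis {s : Set X | IsClopen s}) →
      HasAmbiguousCovers (1 + γ) (Baire × X) := by
    intro γ h
    rcases eq_or_ne γ 0 with rfl | hγ
    · rw [add_zero]
      refine hasAmbiguousCovers_one ?_
      refine (isTopologicalBasis_isClopen.prod (h.resolve_left (by norm_num))).of_isOpen_of_subset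
        (fun s hs => hs.isOpen) ?_
      rintro _ ⟨s, hs, t, ht, rfl⟩
      exact hs.prod ht
    · refine hasAmbiguousCovers_of_two_le ?_
      rw [← one_add_one_eq_two]
      exact add_le_add_right (Order.one_le_iff_ne_zero.2 hγ) 1
  have hone : (1 : Ordinal.{0}) < Ordinal.omega.{0} 1 :=
    Ordinal.one_lt_omega0.trans Ordinal.omega0_lt_omega_one
  induction w generalizing γ with
  | const q => exact ⟨fun _ => q, fun _ _ => rfl, fun A D h => ⟨id, continuous_id, h⟩⟩
  | s δ w ih => exact ih (hshift δ hγ).1 (.inl (hshift δ hγ).2)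
  | Fconst q w ih =>
    exact exists_isUniversalPartition_gluedOn (add_lt_omega_one hone hγ) (hcovers hX)
      (isStable_determinedOn (.const q) γ) (fun i => isStable_determinedOn (w i) γ)
      ⟨fun _ => q, fun _ _ => rfl, fun A D h => ⟨id, continuous_id, h⟩⟩ fun i => ih i hγ hX
  | Ford δ w ih =>
    exact exists_isUniversalPartition_gluedOn (add_lt_omega_one hone hγ) (hcovers hX)
      (isStable_determinedOn (w 0) _) (fun i => isStable_determinedOn (w (i + 1)) γ)
      (ih 0 (hshift δ hγ).1 (.inl (hshift δ hγ).2)) fun i => ih (i + 1) hγ hX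

end Glue

/-! ### Iterated families and determined sets -/

section Trees

variable {X : Type u}

theorem nil_mem_tree {Q : Type v} (w : IFHTerm Q) : [] ∈ w.tree := by
  cases w <;> simp [IFHTerm.tree]

theorem IsMonotoneFamily.subset {T : Set (List ℕ)} {L : Base X} {U : List ℕ → Set X}
    (h : IsMonotoneFamily L T U) (h0 : [] ∈ T) {τ : List ℕ} (hτ : τ ∈ T) : U τ ⊆ L.carrier :=
  h.root ▸ h.mono [] h0 τ hτ (List.nil_prefix)

theorem component_subset (T : Set (List ℕ)) (U : List ℕ → Set X) (τ : List ℕ) :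
    component T U τ ⊆ U τ :=
  Set.sdiff_subset

theorem component_singleton (U : List ℕ → Set X) : component {[]} U [] = U [] := by
  refine Set.Subset.antisymm (component_subset _ _ _) fun x hx => ⟨hx, ?_⟩
  simp only [Set.mem_iUnion, not_exists]
  rintro τ ⟨h, -, hne⟩
  exact absurd h.symm hne

/-- A tree whose root has the trees `T i` above it. -/
def nodeTree (T : ℕ → Set (List ℕ)) : Set (List ℕ) :=
  {[]} ∪ {τ | ∃ i σ, τ = i :: σ ∧ σ ∈ T i}

theorem nil_mem_nodeTree (T : ℕ → Set (List ℕ)) : [] ∈ nodeTree T := by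
  simp [nodeTree]

@[simp]
theorem cons_mem_nodeTree {T : ℕ → Set (List ℕ)} {i : ℕ} {σ : List ℕ} :
    i :: σ ∈ nodeTree T ↔ σ ∈ T i := by
  simp [nodeTree]

theorem component_nodeTree_cons (T : ℕ → Set (List ℕ)) (U : List ℕ → Set X) (i : ℕ)
    (σ : List ℕ) :
    component (nodeTree T) U (i :: σ) = component (T i) (fun σ => U (i :: σ)) σ := by
  unfold component
  congr 1
  ext x
  simp only [Set.mem_iUnion, Set.mem_ofPred_eq, exists_prop]
  constructor
  · rintro ⟨τ, ⟨hτ, ⟨ρ, rfl⟩, hne⟩, hx⟩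
    exact ⟨σ ++ ρ, ⟨by simpa using hτ, List.prefix_append _ _, by simpa using hne⟩, hx⟩
  · rintro ⟨τ, ⟨hτ, hpre, hne⟩, hx⟩
    exact ⟨i :: τ, ⟨by simpa using hτ, (List.cons_prefix_cons).2 ⟨rfl, hpre⟩, by simpa using hne⟩,
      hx⟩

/-- Every node other than the root lies on or above some `[i]`, whose set contains its own. -/
theorem component_nodeTree_nil {T : ℕ → Set (List ℕ)} (h0 : ∀ i, [] ∈ T i)
    {U : List ℕ → Set X} (hU : ∀ i, ∀ σ ∈ T i, U (i :: σ) ⊆ U [i]) :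
    component (nodeTree T) U [] = U [] \ ⋃ i, U [i] := by
  unfold component
  congr 1
  ext x
  simp only [Set.mem_iUnion, Set.mem_ofPred_eq, exists_prop]
  constructor
  · rintro ⟨_ | ⟨i, σ⟩, ⟨hτ, -, hne⟩, hx⟩
    · exact absurd rfl hne
    · exact ⟨i, hU i σ (by simpa using hτ) hx⟩
  · rintro ⟨i, hx⟩
    exact ⟨[i], ⟨by simpa using h0 i, List.nil_prefix, by simp⟩, hx⟩

/-- The family of sets on `nodeTree T` with `D` at the root and `U i` above it. -/
def nodeFamily {β : Type*} (D : β) (U : ℕ → List ℕ → β) : List ℕ → β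
  | [] => D
  | i :: σ => U i σ

end Trees

/-! ### Families over shifts and restrictions of the Borel base -/

section FamilyTrees

variable {X : Type u} [TopologicalSpace X] {Q : Type v}

/-- The restriction to `D` of the `γ`-shift of the Borel base. -/
def shiftedBase (γ : Ordinal.{0}) (D : Set X) : Base X :=
  ((borelBase X).shift γ).restrict D

theorem shiftedBase_shift (γ δ : Ordinal.{0}) (D : Set X) :
    (shiftedBase γ D).shift δ = shiftedBase (γ + δ) D := by
  simp [shiftedBase, Base.shift, Base.restrict, add_assoc]

theorem shiftedBase_restrict (γ : Ordinal.{0}) {D D' : Set X} (h : D' ⊆ D) :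
    (shiftedBase γ D).restrict D' = shiftedBase γ D' := by
  simp only [shiftedBase, Base.restrict, Base.mk.injEq, true_and]
  funext α
  ext B
  constructor
  · rintro ⟨_, ⟨S, hS, rfl⟩, rfl⟩
    exact ⟨S, hS, by rw [← Set.inter_assoc, Set.inter_eq_left.2 h]⟩
  · rintro ⟨S, hS, rfl⟩
    exact ⟨D ∩ S, ⟨S, hS, rfl⟩, by rw [← Set.inter_assoc, Set.inter_eq_left.2 h]⟩

theorem shiftedBase_univ (γ : Ordinal.{0}) :
    shiftedBase γ (Set.univ : Set X) = (borelBase X).shift γ := by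
  simp [shiftedBase, Base.restrict, Base.shift, borelBase]

theorem mem_shiftedBase_zero {γ : Ordinal.{0}} {D B : Set X} :
    B ∈ (shiftedBase γ D).level 0 ↔ ∃ S, BorelSigma (1 + γ) S ∧ B = D ∩ S := by
  simp [shiftedBase, Base.restrict, Base.shift, borelBase]

/-- The `w`-family `F` over the restriction to `D` of the `γ`-shift of the Borel base determines
`A` on `D`. -/
def FamilyDetermines (A : X → Q) (w : IFHTerm Q) (γ : Ordinal.{0}) (D : Set X) (F : Fam X) :
    Prop :=
  IsFamily (shiftedBase γ D) w F ∧ Determines (shiftedBase γ D) w F A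

/-- `(U, F)` is a family indexed by the tree of `w`, over the restriction to `D` of the `γ`-shift of
the Borel base, which determines `A` on `D`. In contrast to `FamilyDetermines`, this is also of
interest when the tree is a singleton. -/
structure TreeDetermines (A : X → Q) (w : IFHTerm Q) (γ : Ordinal.{0}) (D : Set X)
    (U : List ℕ → Set X) (F : List ℕ → Fam X) : Prop where
  monotone : IsMonotoneFamily (shiftedBase γ D) w.tree U
  family : ∀ τ ∈ w.tree, FamilyDetermines A (w.label τ) γ (component w.tree U τ) (F τ)

theorem IsMonotoneFamily.child {T : ℕ → Set (List ℕ)} (h0 : ∀ i, [] ∈ T i) {γ : Ordinal.{0}}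
    {D : Set X} {U : List ℕ → Set X} (h : IsMonotoneFamily (shiftedBase γ D) (nodeTree T) U)
    (i : ℕ) : IsMonotoneFamily (shiftedBase γ (U [i])) (T i) fun σ => U (i :: σ) where
  mem_level σ hσ := by
    have hσ' : i :: σ ∈ nodeTree T := by simpa using hσ
    have hi : [i] ∈ nodeTree T := by simpa using h0 i
    -- The same `S` works relative to `U [i]`, because `U (i :: σ) ⊆ U [i] ⊆ D`.
    obtain ⟨S, hS, hUS⟩ := mem_shiftedBase_zero.1 (h.mem_level _ hσ')
    refine mem_shiftedBase_zero.2 ⟨S, hS, Set.Subset.antisymm (fun x hx => ⟨?_, ?_⟩) ?_⟩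
    · exact h.mono _ hi _ hσ' (by simp) hx
    · rw [hUS] at hx
      exact hx.2
    · rintro x ⟨hx, hxS⟩
      rw [hUS]
      exact ⟨h.subset (nil_mem_nodeTree T) hi hx, hxS⟩
  mono σ hσ σ' hσ' hpre := h.mono _ (by simpa using hσ) _ (by simpa using hσ') (by simpa using hpre)
  root := rfl

theorem isMonotoneFamily_nodeFamily {T : ℕ → Set (List ℕ)} (h0 : ∀ i, [] ∈ T i)
    {γ : Ordinal.{0}} {D : Set X} {U : ℕ → List ℕ → Set X} {S : ℕ → Set X}
    (hS : ∀ i, BorelSigma (1 + γ) (S i))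
    (h : ∀ i, IsMonotoneFamily (shiftedBase γ (D ∩ S i)) (T i) (U i)) :
    IsMonotoneFamily (shiftedBase γ D) (nodeTree T) (nodeFamily D U) where
  mem_level τ hτ := by
    rcases τ with _ | ⟨i, σ⟩
    · exact mem_shiftedBase_zero.2 ⟨Set.univ, .of_isOpen le_self_add isOpen_univ,
        (Set.inter_univ D).symm⟩
    · obtain ⟨S', hS', hUS⟩ := mem_shiftedBase_zero.1 ((h i).mem_level σ (by simpa using hτ))
      exact mem_shiftedBase_zero.2 ⟨S i ∩ S', (hS i).inter hS', by
        rw [← Set.inter_assoc, ← hUS, nodeFamily]⟩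
  mono τ hτ τ' hτ' hpre := by
    rcases τ' with _ | ⟨j, σ'⟩
    · rw [List.prefix_nil.1 hpre]
    have hσ' : σ' ∈ T j := by simpa using hτ'
    rcases τ with _ | ⟨i, σ⟩
    · exact ((h j).subset (h0 j) hσ').trans Set.inter_subset_left
    · obtain ⟨rfl, hp⟩ := List.cons_prefix_cons.1 hpre
      exact (h i).mono σ (by simpa using hτ) σ' hσ' hp
  root := rfl

theorem familyDetermines_s_iff {A : X → Q} {δ : CountableOrdinal} {w : IFHTerm Q}
    {γ : Ordinal.{0}} {D : Set X} {F : Fam X} : FamilyDetermines A (.s δ w) γ D F ↔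
      FamilyDetermines A w (γ + Ordinal.omega0 ^ δ.1) D F := by
  simp only [FamilyDetermines, ← shiftedBase_shift]
  constructor
  · rintro ⟨h1, h2⟩
    cases h1 with
    | s _ _ _ _ h1 =>
      cases h2 with
      | s _ _ _ _ _ h2 => exact ⟨h1, h2⟩
  · rintro ⟨h1, h2⟩
    exact ⟨.s _ _ _ _ h1, .s _ _ _ _ _ h2⟩

theorem familyDetermines_const_iff {A : X → Q} {q : Q} {γ : Ordinal.{0}} {D : Set X}
    {F : Fam X} : FamilyDetermines A (.const q) γ D F ↔ F = .single D ∧ ∀ x ∈ D, A x = q := by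
  constructor
  · rintro ⟨h1, h2⟩
    cases h1
    cases h2 with
    | const _ _ _ _ h2 => exact ⟨rfl, h2⟩
  · rintro ⟨rfl, h⟩
    exact ⟨.const (shiftedBase γ D) q, .const _ _ _ _ h⟩

theorem component_subset_carrier {w : IFHTerm Q} {γ : Ordinal.{0}} {D : Set X}
    {U : List ℕ → Set X} (h : IsMonotoneFamily (shiftedBase γ D) w.tree U) {τ : List ℕ}
    (hτ : τ ∈ w.tree) : component w.tree U τ ⊆ D :=
  (component_subset _ _ _).trans (h.subset (nil_mem_tree w) hτ)

/-- For constants and `s`-terms, the tree formulation merely wraps the family in a singleton tree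
whose only component is `D`. This makes all subterms of an `ω`-ary symbol uniform, as some of their
trees may be singletons. -/
theorem exists_familyDetermines_iff_treeDetermines {A : X → Q} {w : IFHTerm Q} {γ : Ordinal.{0}}
    {D : Set X} : (∃ F, FamilyDetermines A w γ D F) ↔ ∃ U F, TreeDetermines A w γ D U F := by
  have singleton : ∀ {w : IFHTerm Q}, w.tree = {[]} → w.label [] = w →
      ((∃ F, FamilyDetermines A w γ D F) ↔ ∃ U F, TreeDetermines A w γ D U F) := by
    intro w hT hl
    constructor
    · rintro ⟨F, hF⟩
      refine ⟨fun _ => D, fun _ => F, ⟨fun τ _ => ?_, fun _ _ _ _ _ => le_rfl, rfl⟩, ?_⟩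
      · exact mem_shiftedBase_zero.2 ⟨Set.univ, .of_isOpen le_self_add isOpen_univ,
          (Set.inter_univ D).symm⟩
      · intro τ hτ
        rw [hT] at hτ ⊢
        obtain rfl : τ = [] := hτ
        rwa [component_singleton, hl]
    · rintro ⟨U, F, h⟩
      have := h.family [] (nil_mem_tree w)
      rw [hT, component_singleton, hl, h.monotone.root] at this
      exact ⟨_, this⟩
  cases w with
  | const q => exact singleton rfl rfl
  | s δ w => exact singleton rfl rfl
  | Fconst q w =>
    constructor
    · rintro ⟨_, h1, h2⟩
      cases h1 with
      | Fconst _ _ _ U F hU hF =>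
        cases h2 with
        | Fconst _ _ _ _ _ _ h2 =>
          refine ⟨U, F, hU, fun τ hτ => ?_⟩
          rw [FamilyDetermines, ← shiftedBase_restrict γ (component_subset_carrier hU hτ)]
          exact ⟨hF τ hτ, h2 τ hτ⟩
    · rintro ⟨U, F, hU, hF⟩
      refine ⟨.node U F, .Fconst _ _ _ _ _ hU fun τ hτ => ?_, .Fconst _ _ _ _ _ _ fun τ hτ => ?_⟩
      all_goals rw [shiftedBase_restrict γ (component_subset_carrier hU hτ)]
      exacts [(hF τ hτ).1, (hF τ hτ).2]
  | Ford δ w =>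
    constructor
    · rintro ⟨_, h1, h2⟩
      cases h1 with
      | Ford _ _ _ U F hU hF =>
        cases h2 with
        | Ford _ _ _ _ _ _ h2 =>
          refine ⟨U, F, hU, fun τ hτ => ?_⟩
          rw [FamilyDetermines, ← shiftedBase_restrict γ (component_subset_carrier hU hτ)]
          exact ⟨hF τ hτ, h2 τ hτ⟩
    · rintro ⟨U, F, hU, hF⟩
      refine ⟨.node U F, .Ford _ _ _ _ _ hU fun τ hτ => ?_, .Ford _ _ _ _ _ _ fun τ hτ => ?_⟩
      all_goals rw [shiftedBase_restrict γ (component_subset_carrier hU hτ)]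
      exacts [(hF τ hτ).1, (hF τ hτ).2]

/-- Cutting the tree at its root: the sets `U [i] = D ∩ S i` carry the families of the subterms, and
the root component is `D \ ⋃ i, S i`. Conversely, subfamilies over `D ∩ S i` are reassembled because
`Σ⁰_{1+γ}` is closed under finite intersections. The term `u` is abstract so as to cover both kinds
of `ω`-ary symbols. -/
theorem exists_treeDetermines_node_iff {A : X → Q} {u r : IFHTerm Q} {w : ℕ → IFHTerm Q}
    (hT : u.tree = nodeTree fun i => (w i).tree) (hr : u.label [] = r)
    (hl : ∀ i σ, u.label (i :: σ) = (w i).label σ) {γ : Ordinal.{0}} {D : Set X} :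
    (∃ U F, TreeDetermines A u γ D U F) ↔
      GluedOn (1 + γ) (fun B => ∃ F, FamilyDetermines A r γ B F)
        (fun i B => ∃ U F, TreeDetermines A (w i) γ B U F) D := by
  have h0 : ∀ i, [] ∈ (w i).tree := fun i => nil_mem_tree (w i)
  constructor
  · rintro ⟨U, F, hU, hF⟩
    rw [hT] at hU hF
    have hi : ∀ i, [i] ∈ nodeTree fun i => (w i).tree := fun i => by simpa using h0 i
    choose S hS hUS using fun i => mem_shiftedBase_zero.1 (hU.mem_level [i] (hi i))
    refine ⟨S, hS, fun i => ⟨_, fun σ => F (i :: σ), hUS i ▸ hU.child h0 i, fun σ hσ => ?_⟩,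
      F [], ?_⟩
    · have := hF (i :: σ) (by simpa using hσ)
      rwa [hl, component_nodeTree_cons] at this
    · have := hF [] (nil_mem_nodeTree _)
      have hroot : U [] = D := hU.root
      rw [hr, component_nodeTree_nil h0 fun i σ hσ =>
        hU.mono _ (hi i) _ (by simpa using hσ) (by simp), hroot] at this
      simpa only [hUS, ← Set.inter_iUnion, Set.sdiff_self_inter] using this
  · rintro ⟨S, hS, h, F₀, hF₀⟩
    choose U F hUF using h
    have hmono := isMonotoneFamily_nodeFamily h0 hS fun i => (hUF i).monotone
    refine ⟨nodeFamily D U, nodeFamily F₀ F, hT ▸ hmono, ?_⟩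
    rw [hT]
    rintro (_ | ⟨i, σ⟩) hτ
    · have hroot : ∀ i, U i [] = D ∩ S i := fun i => (hUF i).monotone.root
      rw [hr, component_nodeTree_nil h0 fun i σ hσ =>
        hmono.mono _ (by simpa using h0 i) _ (by simpa using hσ) (by simp)]
      simp only [nodeFamily, hroot, ← Set.inter_iUnion, Set.sdiff_self_inter]
      exact hF₀
    · rw [hl, component_nodeTree_cons]
      exact (hUF i).family σ (by simpa using hτ)

theorem exists_familyDetermines_iff {A : X → Q} {w : IFHTerm Q} {γ : Ordinal.{0}} {D : Set X} :
    (∃ F, FamilyDetermines A w γ D F) ↔ DeterminedOn A w γ D := by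
  induction w generalizing γ D with
  | const q => simp [familyDetermines_const_iff, DeterminedOn]
  | s δ w ih => simp only [familyDetermines_s_iff, ih, DeterminedOn]
  | Fconst q w ih =>
    rw [exists_familyDetermines_iff_treeDetermines, exists_treeDetermines_node_iff
      (w := w) (r := .const q) rfl rfl fun _ _ => rfl]
    simp only [← exists_familyDetermines_iff_treeDetermines, ih, familyDetermines_const_iff,
      exists_eq_left, DeterminedOn]
  | Ford δ w ih =>
    rw [exists_familyDetermines_iff_treeDetermines, exists_treeDetermines_node_iff
      (w := fun i => w (i + 1)) (r := .s δ (w 0)) rfl rfl fun _ _ => rfl]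
    simp only [← exists_familyDetermines_iff_treeDetermines, ih, familyDetermines_s_iff,
      DeterminedOn]

theorem mem_ifhLevel_shift_iff {A : X → Q} {w : IFHTerm Q} {γ : Ordinal.{0}} :
    A ∈ ifhLevel ((borelBase X).shift γ) w ↔ DeterminedOn A w γ Set.univ := by
  rw [← exists_familyDetermines_iff, ← shiftedBase_univ]
  rfl

theorem borelBase_shift_zero : (borelBase X).shift 0 = borelBase X := by
  simp [Base.shift]

end FamilyTrees

/-! ### Principal total representations -/

theorem exists_isPrincipalTR {Q : Type v} {X : Type u} [TopologicalSpace X]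
    [SecondCountableTopology X] (w : IFHTerm Q) {γ : Ordinal.{0}} (hγ : γ < Ordinal.omega.{0} 1)
    (hX : 1 ≤ γ ∨ IsTopologicalBasis {s : Set X | IsClopen s}) {Γ : PartitionClass.{u} Q}
    (hΓ : ∀ (Y : Type u) [TopologicalSpace Y], Γ Y = ifhLevel ((borelBase Y).shift γ) w) :
    ∃ ν : Baire → Γ X, IsPrincipalTR Γ X ν := by
  have hmem : ∀ {Y : Type u} [TopologicalSpace Y] {A : Y → Q},
      A ∈ Γ Y ↔ DeterminedOn A w γ Set.univ := by
    intro Y _ A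
    rw [hΓ, mem_ifhLevel_shift_iff]
  obtain ⟨v, hv, hred⟩ := exists_isUniversalPartition_determinedOn (Q := Q) w hγ hX
  refine ⟨fun a => ⟨fun x => v (a, x), hmem.2 ?_⟩, ?_, hmem.2 hv, fun μ hμ => ?_⟩
  · exact DeterminedOn.preimage hv (Continuous.prodMk_right a)
  · rintro ⟨A, hA⟩
    -- The pulled-back partition does not depend on the code, so `g` may be evaluated at any point,
    -- here `0`.
    obtain ⟨g, -, hg⟩ := hred (A ∘ Prod.snd) Set.univ ((hmem.1 hA).preimage continuous_snd)
    exact ⟨g 0, Subtype.ext (funext fun x => (hg (0, x) trivial).symm)⟩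
  · obtain ⟨g, hgc, hg⟩ := hred _ Set.univ (hmem.1 hμ)
    exact ⟨g, hgc, funext fun a => Subtype.ext (funext fun x => hg (a, x) trivial)⟩

end IFH

theorem mainTheorem8 (Q : Type*) [Preorder Q] (X : Type*) [TopologicalSpace X]
    [SecondCountableTopology X] [T0Space X] :
    (∀ w : IFH.IFHTerm Q, ∃ ν : IFH.Baire → IFH.borelIFHShiftOne w X,
      IFH.IsPrincipalTR (IFH.borelIFHShiftOne w) X ν) ∧
    (TopologicalSpace.IsTopologicalBasis {s : Set X | IsClopen s} →
      ∀ w : IFH.IFHTerm Q, ∃ ν : IFH.Baire → IFH.borelIFH w X,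
        IFH.IsPrincipalTR (IFH.borelIFH w) X ν) := by
  refine ⟨fun w => ?_, fun hX w => ?_⟩
  · exact IFH.exists_isPrincipalTR w (Ordinal.one_lt_omega0.trans Ordinal.omega0_lt_omega_one)
      (.inl le_rfl) fun _ _ => rfl
  · exact IFH.exists_isPrincipalTR w (Ordinal.omega0_pos.trans Ordinal.omega0_lt_omega_one)
      (.inr hX) fun _ _ => by rw [IFH.borelBase_shift_zero]; rfl
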